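/- **Theorem.** Let $H,G>0$, let $\mathcal W\subset\mathbb R^d$ be non-empty, convex, closed and bounded, let $B=\sup_{w\in\mathcal W}\|w\|_\infty$ and let $\mathcal D=\{x\in\mathbb R^d:\|x\|_\infty\le B\}$ be the circumscribing box. Let $f_1,\dots,f_n$ be losses that are $H$-strongly convex across $\mathcal D$ in the Euclidean norm, i.e. $f_t(y)\ge f_t(x)+\nabla f_t(x)^T(y-x)+\frac H2\|y-x\|_2^2$ for all $x,y\in\mathcal D$, and satisfy $\|\nabla f_t(x)\|_\infty\le G$ for all $x\in\mathcal D$ (if $f_t$ is not differentiable, $\nabla f_t(x)$ stands for a choice of subgradient with these two properties). Write $\Pi_{\mathcal W}(x)\in\arg\min_{y\in\mathcal W}\|x-y\|_1$ for an (arbitrary) choice of $\ell_1$-projection and $S(x)=\|x-\Pi_{\mathcal W}(x)\|_1$. Consider the following learner, which knows $\mathcal W$, $H$ and $G$ only. In round $t=1,\dots,n$: 1. it computes a point $x_t$ coordinate by coordinate: $x_t[i]$ is the prediction of the $i$-th of $d$ instances of the univariate algorithm FLH-OGD described below, with decision set $[-B,B]$ and learning rate $\zeta=1/\big(2(2B+2G/H)^2\big)$;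 2. it plays $\hat x_t=\Pi_{\mathcal W}(x_t)$, and the loss $f_t$ is revealed; 3. it takes a subgradient $p_t=\nabla f_t(x_t)+G s_t$, $s_t\in\partial S(x_t)$, of the surrogate loss $\ell_t(x)=f_t(x)+G\,S(x)$ at $x_t$, and sends to the $i$-th instance the univariate loss $\ell_t^{(i)}(z)=\big(z-(x_t[i]-p_t[i]/H)\big)^2$, $i=1,\dots,d$. FLH-OGD on losses $h_1,h_2,\dots$ works as follows. Base learner $j$ ($j=1,2,\dots$) is started at time $j$ from an arbitrary point of $[-B,B]$ and runs projected online gradient descent on $[-B,B]$ with step size $1/(2k)$ after its $k$-th round; let $E^j_t$ be its prediction at time $t\ge j$. The prediction at time $t$ is $\sum_{j=1}^t v_t^{(j)}E^j_t$, where $v_1^{(1)}=1$, $v_{t+1}^{(t+1)}=\frac1{t+1}$ and, for $1\le i\le t$, $v_{t+1}^{(i)}=\big(1-\frac1{t+1}\big)\,v_t^{(i)}e^{-\zeta h_t(E^i_t)}\big/\sum_{j=1}^t v_t^{(j)}e^{-\zeta h_t(E^j_t)}$. Then the learner is proper, $\hat x_t\in\mathcal W$ for all $t$, and simultaneously for every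 $C_n$ and every comparator sequence $w_1,\dots,w_n\in\mathcal W$ with $\sum_{t=2}^n\|w_t-w_{t-1}\|_1\le C_n$, $$\sum_{t=1}^n\big(f_t(\hat x_t)-f_t(w_t)\big)\;\le\;K\,(1+\log n)^k\,\max\big\{d^{1/3}n^{1/3}C_n^{2/3},\;d\big\},$$ where $k$ is an absolute constant and $K$ depends only on $H$ and $G$. -/

import Mathlib

open Finset

noncomputable section

namespace BoxReduction

/-! ### Univariate FLH-OGD -/

/-- Projection of a real number onto the interval `[-B, B]`. -/
def clip (B z : ℝ) : ℝ := max (-B) (min B z)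

/-- Projected online gradient descent on `[-B, B]`, started at time `j` from the point `z₁`, on the
losses `f j, f (j + 1), …`. `ogd B z₁ f j τ` is the prediction at time `j + τ`; the step size used
after the `k`-th round of play is `1 / (2 k)`. -/
def ogd (B z₁ : ℝ) (f : ℕ → ℝ → ℝ) (j : ℕ) : ℕ → ℝ
  | 0 => z₁
  | τ + 1 =>
    clip B (ogd B z₁ f j τ
      - 1 / (2 * ((τ : ℝ) + 1)) * deriv (f (j + τ)) (ogd B z₁ f j τ))

/-- The weights `v_t^{(i)}` of Follow-the-Leading-History with learning rate `ζ`, where `E i t` is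
the prediction of base learner `i` at time `t` (`1 ≤ i ≤ t`) and `f t` is the loss at time `t`.
The equation at `t + 1` with `t = 0` is the initialization `v_1^{(1)} = 1`. -/
def flhWeight (ζ : ℝ) (E : ℕ → ℕ → ℝ) (f : ℕ → ℝ → ℝ) : ℕ → ℕ → ℝ
  | 0, _ => 0
  | t + 1, i =>
    if i = t + 1 then 1 / ((t : ℝ) + 1)
    else (1 - 1 / ((t : ℝ) + 1)) *
      (flhWeight ζ E f t i * Real.exp (-ζ * f t (E i t)) /
        ∑ j ∈ Icc 1 t, flhWeight ζ E f t j * Real.exp (-ζ * f t (E j t)))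

/-- The prediction of FLH at time `t ≥ 1`. -/
def flhPlay (ζ : ℝ) (E : ℕ → ℕ → ℝ) (f : ℕ → ℝ → ℝ) (t : ℕ) : ℝ :=
  ∑ j ∈ Icc 1 t, flhWeight ζ E f t j * E j t

/-- The prediction at time `t ≥ 1` of univariate FLH-OGD on `[-B, B]` with learning rate `ζ`: base
learner `j` is projected OGD started at time `j` from the point `z₁ j`. It depends only on the
losses `f 1, …, f (t - 1)`. -/
def flhOgd (B ζ : ℝ) (z₁ : ℕ → ℝ) (f : ℕ → ℝ → ℝ) (t : ℕ) : ℝ :=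
  flhPlay ζ (fun j s => ogd B (z₁ j) f j (s - j)) f t

/-! ### Vectors in `ℝ^d`; the norm of `Fin d → ℝ` is the sup norm -/

/-- The `ℓ¹` norm. -/
def l1Norm {d : ℕ} (x : Fin d → ℝ) : ℝ := ∑ i, |x i|

/-- `TV(w_{1:n}) = ∑_{t=2}^n ‖w_t - w_{t-1}‖₁`. -/
def totalVariation {d : ℕ} (n : ℕ) (w : ℕ → Fin d → ℝ) : ℝ :=
  ∑ t ∈ Icc 2 n, l1Norm (w t - w (t - 1))

/-- The box `{x : ‖x‖_∞ ≤ B}`. -/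
def box (d : ℕ) (B : ℝ) : Set (Fin d → ℝ) := {x | ‖x‖ ≤ B}

/-- `sup_{w ∈ W} ‖w‖_∞`, the radius of the tightest centred box that contains `W`. -/
def boxRadius {d : ℕ} (W : Set (Fin d → ℝ)) : ℝ := sSup ((fun w => ‖w‖) '' W)

/-- `f` is `H`-strongly convex in the Euclidean norm across the box of radius `B`, with (sub)gradient
map `g` bounded by `G` in sup norm. If `f` is differentiable then `g` can be taken to be `∇f`; at an
interior point of the box where `f` is differentiable, `g x = ∇f x` is the only possibility. -/
structure IsStronglyConvexLoss {d : ℕ} (H G B : ℝ) (f : (Fin d → ℝ) → ℝ)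
    (g : (Fin d → ℝ) → (Fin d → ℝ)) : Prop where
  strong : ∀ x ∈ box d B, ∀ y ∈ box d B,
    f x + ∑ i, g x i * (y i - x i) + H / 2 * ∑ i, (y i - x i) ^ 2 ≤ f y
  bound : ∀ x ∈ box d B, ‖g x‖ ≤ G

/-- `proj x` is a point of `argmin_{y ∈ W} ‖x - y‖₁`, for every `x`. -/
def IsL1Projection {d : ℕ} (W : Set (Fin d → ℝ)) (proj : (Fin d → ℝ) → (Fin d → ℝ)) : Prop :=
  ∀ x, proj x ∈ W ∧ ∀ y ∈ W, l1Norm (x - proj x) ≤ l1Norm (x - y)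

/-- `S(x) = ‖x - Π_W(x)‖₁`. -/
def l1Gap {d : ℕ} (proj : (Fin d → ℝ) → (Fin d → ℝ)) (x : Fin d → ℝ) : ℝ :=
  l1Norm (x - proj x)

/-- The subdifferential at `x` of a function on `ℝ^d`. -/
def subdifferential {d : ℕ} (S : (Fin d → ℝ) → ℝ) (x : Fin d → ℝ) : Set (Fin d → ℝ) :=
  {s | ∀ y, S x + ∑ i, s i * (y i - x i) ≤ S y}

/-- The values at `x` of the (sub)gradient of the surrogate loss `ℓ = f + G • S`, where
`S(x) = ‖x - Π_W(x)‖₁` and `g` is the (sub)gradient map of `f`: the vectors `g x + G • s` with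
`s` a subgradient of `S` at `x`. -/
def surrogateGradients {d : ℕ} (G : ℝ) (proj g : (Fin d → ℝ) → (Fin d → ℝ)) (x : Fin d → ℝ) :
    Set (Fin d → ℝ) :=
  {p | ∃ s ∈ subdifferential (l1Gap proj) x, p = g x + G • s}

/-! ### The algorithm for the box and the reduction -/

/-- The univariate surrogate losses `z ↦ (z - (x_t[i] - p_t[i] / H))²` of coordinate `i`, where `x_t`
is the prediction and `p_t` the (sub)gradient received at `x_t`. -/
def coordLoss {d : ℕ} (H : ℝ) (x p : ℕ → Fin d → ℝ) (i : Fin d) (t : ℕ) (z : ℝ) : ℝ :=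
  (z - (x t i - p t i / H)) ^ 2

/-- `x` is the sequence of predictions over `n` rounds of the algorithm for the box of radius `B`
(`d` instances of FLH-OGD, one for each coordinate) with parameters `H`, `Ginf` and starting points
`z₁`, when the (sub)gradient received in round `t` is `p t`. -/
def IsBoxAlgorithmRun {d : ℕ} (n : ℕ) (B H Ginf : ℝ) (z₁ : Fin d → ℕ → ℝ)
    (p x : ℕ → Fin d → ℝ) : Prop :=
  ∀ t ∈ Icc 1 n, ∀ i,
    x t i = flhOgd B (1 / (2 * (2 * B + Ginf / H) ^ 2)) (z₁ i) (coordLoss H x p i) t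

/-- A run over `n` rounds of the reduction from the convex set `W` to its circumscribing box, against
losses with (sub)gradient maps `g t`: in round `t` the box algorithm, run with `Ginf = 2 G`, predicts
`x t`, the learner plays `xhat t`, and the box algorithm is sent the surrogate loss
`ℓ_t = f_t + G • S`, of which it uses the (sub)gradient `p t` at `x t`. -/
structure IsReductionRun {d : ℕ} (n : ℕ) (W : Set (Fin d → ℝ)) (H G : ℝ)
    (proj : (Fin d → ℝ) → (Fin d → ℝ)) (g : ℕ → (Fin d → ℝ) → (Fin d → ℝ))
    (z₁ : Fin d → ℕ → ℝ) (p x xhat : ℕ → Fin d → ℝ) : Prop where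
  start : ∀ i j, z₁ i j ∈ Set.Icc (-boxRadius W) (boxRadius W)
  predict : IsBoxAlgorithmRun n (boxRadius W) H (2 * G) z₁ p x
  play : ∀ t ∈ Icc 1 n, xhat t = proj (x t)
  feedback : ∀ t ∈ Icc 1 n, p t ∈ surrogateGradients G proj (g t) (x t)

end BoxReduction

end

/-!
The surrogate losses sent to a coordinate are squares with targets within `D = 2 B + 2 G / H` of
every point of `[-B, B]`. They are exp-concave with parameter `1 / (2 D²)`, so that FLH loses only
`O(D² log n)` against any base learner on any interval, and strongly convex, so that each base
learner has logarithmic regret from its start on; a moving comparator adds at most `4 B` times the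
length of the interval times the variation of the comparator.

Let a univariate comparator have variation `V = q³ n`. If `q ≤ 2 B`, round it to a grid of mesh
about `q` with one random threshold. The rounding is unbiased, so only the second order errors
`n q²` remain in the mean, and the rounded comparator changes about `V / q = n q²` times in the
mean; adaptive regret pays for each constant piece. If `q > 2 B`, the grid would be coarser than the
interval; cut the rounds instead into blocks of length `1 / q²`, on each of which the regret against
the moving comparator is controlled directly. In both cases the regret is
`O(log n (1 + n q²)) = O(log n (1 + n^{1/3} V^{2/3}))`.

Strong convexity of `f_t` and the subgradient inequality for `S` bound the regret of the plays by
`H / 2` times the sum of the univariate regrets, the term `G S(x_t)` paying for the projection of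
`x_t` onto `W`. Concavity of the power `2 / 3` combines the variations of the coordinates. Finally,
bounded gradients and strong convexity on the same box force `B ≤ G / H`, which removes `B` from the
constants.
-/

namespace BoxReduction

/-! ### Projected online gradient descent -/

section Ogd

variable {B G z u : ℝ} {f : ℕ → ℝ → ℝ} {j : ℕ}

lemma clip_mem (hB : 0 ≤ B) (z : ℝ) : clip B z ∈ Set.Icc (-B) B :=
  ⟨le_max_left _ _, max_le (by linarith) (min_le_left _ _)⟩

lemma abs_clip_sub_le (hu : u ∈ Set.Icc (-B) B) (z : ℝ) : |clip B z - u| ≤ |z - u| := by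
  have h := Set.abs_projIcc_sub_projIcc (c := z) (d := u) (hu.1.trans hu.2)
  rwa [Set.projIcc_of_mem _ hu, Set.coe_projIcc] at h

lemma ogd_mem (hz : z ∈ Set.Icc (-B) B) (f : ℕ → ℝ → ℝ) (j τ : ℕ) :
    ogd B z f j τ ∈ Set.Icc (-B) B := by
  cases τ with
  | zero => exact hz
  | succ τ => exact clip_mem (by linarith [hz.1, hz.2]) _

/-- The univariate losses for which the step sizes `1 / (2 k)` of `ogd` are tuned: `h` is strongly
convex with modulus `2` on `[-B, B]`, in the form of the first-order inequality, and its derivative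
is at most `G` in absolute value there. -/
structure IsOgdLoss (B G : ℝ) (h : ℝ → ℝ) : Prop where
  strong : ∀ x ∈ Set.Icc (-B) B, ∀ y ∈ Set.Icc (-B) B,
    h x + deriv h x * (y - x) + (y - x) ^ 2 ≤ h y
  bound : ∀ x ∈ Set.Icc (-B) B, |deriv h x| ≤ G

/-- The variation `∑ |w t - w (t - 1)|` of `w` over the rounds `r, …, s - 1`. -/
noncomputable def pathLength (w : ℕ → ℝ) (r s : ℕ) : ℝ := ∑ t ∈ Ico (r + 1) s, |w t - w (t - 1)|

lemma pathLength_nonneg (w : ℕ → ℝ) (r s : ℕ) : 0 ≤ pathLength w r s :=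
  sum_nonneg fun _ _ => abs_nonneg _

lemma ogd_succ_sub_sq_le (hz : z ∈ Set.Icc (-B) B) (hu : u ∈ Set.Icc (-B) B) (τ : ℕ)
    (hf : IsOgdLoss B G (f (j + τ))) :
    f (j + τ) (ogd B z f j τ) - f (j + τ) u + (τ + 1) * (ogd B z f j (τ + 1) - u) ^ 2 ≤
      τ * (ogd B z f j τ - u) ^ 2 + G ^ 2 / 4 * ((τ : ℝ) + 1)⁻¹ := by
  have he := ogd_mem hz f j τ
  have hproj := sq_le_sq.2 (abs_clip_sub_le hu (ogd B z f j τ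
    - 1 / (2 * ((τ : ℝ) + 1)) * deriv (f (j + τ)) (ogd B z f j τ)))
  rw [ogd]
  set e := ogd B z f j τ
  set p := deriv (f (j + τ)) e
  have hp : p ^ 2 ≤ G ^ 2 := sq_le_sq.2 ((hf.bound e he).trans (le_abs_self G))
  calc _ ≤ p * (e - u) - (e - u) ^ 2 + (τ + 1) * (e - 1 / (2 * ((τ : ℝ) + 1)) * p - u) ^ 2 := by
        have hτ : (0 : ℝ) ≤ τ + 1 := by positivity
        linarith [hf.strong e he u hu, mul_le_mul_of_nonneg_left hproj hτ]
    _ = τ * (e - u) ^ 2 + p ^ 2 / 4 * ((τ : ℝ) + 1)⁻¹ := by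
        field_simp
        ring
    _ ≤ _ := by gcongr

lemma sub_sq_le_add_mul_abs_sub {e v : ℝ} (he : e ∈ Set.Icc (-B) B) (hu : u ∈ Set.Icc (-B) B)
    (hv : v ∈ Set.Icc (-B) B) : (e - v) ^ 2 ≤ (e - u) ^ 2 + 4 * B * |v - u| := by
  have h : |u + v - 2 * e| ≤ 4 * B := by
    rw [abs_le]
    constructor <;> linarith [he.1, he.2, hu.1, hu.2, hv.1, hv.2]
  calc (e - v) ^ 2 = (e - u) ^ 2 + (u + v - 2 * e) * (v - u) := by ring
    _ ≤ (e - u) ^ 2 + |u + v - 2 * e| * |v - u| := by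
        rw [← abs_mul]
        gcongr
        exact le_abs_self _
    _ ≤ (e - u) ^ 2 + 4 * B * |v - u| := by gcongr

lemma ogd_dynamic_regret_add_le (hz : z ∈ Set.Icc (-B) B) {w : ℕ → ℝ} (m : ℕ)
    (hf : ∀ t ∈ Ico j (j + m), IsOgdLoss B G (f t))
    (hw : ∀ t ∈ Ico j (j + m), w t ∈ Set.Icc (-B) B) :
    ∑ t ∈ Ico j (j + m), (f t (ogd B z f j (t - j)) - f t (w t))
        + m * (ogd B z f j m - w (j + m - 1)) ^ 2 ≤
      G ^ 2 / 4 * harmonic m + 4 * B * m * pathLength w j (j + m) := by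
  have hB : 0 ≤ B := by linarith [hz.1, hz.2]
  induction m with
  | zero => simp
  | succ m ih =>
    have hm : j + m ∈ Ico j (j + (m + 1)) := by simp
    have hsub : Ico j (j + m) ⊆ Ico j (j + (m + 1)) := Ico_subset_Ico_right (by lia)
    have ih := ih (fun t ht => hf t (hsub ht)) (fun t ht => hw t (hsub ht))
    have hstep := ogd_succ_sub_sq_le hz (hw _ hm) m (hf _ hm)
    -- Replacing the comparator in the potential costs its displacement.
    have hmove : m * (ogd B z f j m - w (j + m)) ^ 2 + 4 * B * m * pathLength w j (j + m) ≤
        m * (ogd B z f j m - w (j + m - 1)) ^ 2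
          + 4 * B * (m + 1) * pathLength w j (j + m + 1) := by
      rcases m.eq_zero_or_pos with rfl | hm0
      · simp [pathLength]
      have hprev := hw (j + m - 1) (mem_Ico.2 ⟨by lia, by lia⟩)
      have hdist := sub_sq_le_add_mul_abs_sub (ogd_mem hz f j m) hprev (hw _ hm)
      have hpath : pathLength w j (j + m + 1) =
          pathLength w j (j + m) + |w (j + m) - w (j + m - 1)| :=
        sum_Ico_succ_top (by lia) _
      have hnonneg : 0 ≤ pathLength w j (j + m) + |w (j + m) - w (j + m - 1)| :=
        add_nonneg (pathLength_nonneg _ _ _) (abs_nonneg _)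
      rw [hpath]
      nlinarith [mul_le_mul_of_nonneg_left hdist m.cast_nonneg (α := ℝ), mul_nonneg hB hnonneg]
    rw [← add_assoc, sum_Ico_succ_top (by lia), harmonic_succ, add_assoc j m 1,
      Nat.add_sub_cancel_left, ← add_assoc j m 1, Nat.add_sub_cancel]
    push_cast at *
    linarith

lemma ogd_dynamic_regret (hz : z ∈ Set.Icc (-B) B) {w : ℕ → ℝ} (m : ℕ)
    (hf : ∀ t ∈ Ico j (j + m), IsOgdLoss B G (f t))
    (hw : ∀ t ∈ Ico j (j + m), w t ∈ Set.Icc (-B) B) :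
    ∑ t ∈ Ico j (j + m), (f t (ogd B z f j (t - j)) - f t (w t)) ≤
      G ^ 2 / 4 * harmonic m + 4 * B * m * pathLength w j (j + m) := by
  have h : 0 ≤ m * (ogd B z f j m - w (j + m - 1)) ^ 2 := by positivity
  linarith [ogd_dynamic_regret_add_le hz m hf hw]

end Ogd

/-! ### Follow-the-Leading-History -/

section Flh

variable (ζ : ℝ) (E : ℕ → ℕ → ℝ) (f : ℕ → ℝ → ℝ)

/-- The normalizing factor `Z_t` of the exponential weights update after round `t`. -/
noncomputable def flhMix (t : ℕ) : ℝ :=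
  ∑ j ∈ Icc 1 t, flhWeight ζ E f t j * Real.exp (-ζ * f t (E j t))

lemma flhWeight_succ_self (t : ℕ) : flhWeight ζ E f (t + 1) (t + 1) = ((t : ℝ) + 1)⁻¹ := by
  rw [flhWeight, if_pos rfl, one_div]

lemma flhWeight_succ_of_le {t i : ℕ} (hi : i ≤ t) :
    flhWeight ζ E f (t + 1) i =
      t * ((t : ℝ) + 1)⁻¹ *
        (flhWeight ζ E f t i * Real.exp (-ζ * f t (E i t)) / flhMix ζ E f t) := by
  have h : 1 - 1 / ((t : ℝ) + 1) = t * ((t : ℝ) + 1)⁻¹ := by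
    field_simp
    ring
  rw [flhWeight, if_neg (by lia), h, flhMix]

lemma flhMix_pos_of_flhWeight_pos {t : ℕ} (ht : 1 ≤ t)
    (h : ∀ i ∈ Icc 1 t, 0 < flhWeight ζ E f t i) : 0 < flhMix ζ E f t :=
  sum_pos (fun j hj => mul_pos (h j hj) (Real.exp_pos _)) ⟨1, by simp [ht]⟩

lemma flhWeight_pos {t : ℕ} (ht : 1 ≤ t) : ∀ i ∈ Icc 1 t, 0 < flhWeight ζ E f t i := by
  induction t, ht using Nat.le_induction with
  | base =>
    intro i hi
    obtain rfl : i = 1 := by simpa using hi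
    simp [flhWeight]
  | succ t ht ih =>
    intro i hi
    rcases (mem_Icc.1 hi).2.eq_or_lt with rfl | hit
    · rw [flhWeight_succ_self]
      positivity
    · have hvi := ih i (mem_Icc.2 ⟨(mem_Icc.1 hi).1, by lia⟩)
      have hmix := flhMix_pos_of_flhWeight_pos ζ E f ht ih
      rw [flhWeight_succ_of_le ζ E f (by lia)]
      positivity

lemma flhMix_pos {t : ℕ} (ht : 1 ≤ t) : 0 < flhMix ζ E f t :=
  flhMix_pos_of_flhWeight_pos ζ E f ht (flhWeight_pos ζ E f ht)

lemma sum_flhWeight {t : ℕ} (ht : 1 ≤ t) : ∑ i ∈ Icc 1 t, flhWeight ζ E f t i = 1 := by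
  obtain ⟨t, rfl⟩ : ∃ s, t = s + 1 := ⟨t - 1, by lia⟩
  rcases t.eq_zero_or_pos with rfl | ht
  · simp [flhWeight]
  have hold : ∑ i ∈ Icc 1 t, flhWeight ζ E f (t + 1) i = t * ((t : ℝ) + 1)⁻¹ := by
    rw [sum_congr rfl fun i hi => flhWeight_succ_of_le ζ E f (mem_Icc.1 hi).2, ← mul_sum,
      ← sum_div, ← flhMix, div_self (flhMix_pos ζ E f ht).ne', mul_one]
  rw [sum_Icc_succ_top (by lia), hold, flhWeight_succ_self, ← add_one_mul,
    mul_inv_cancel₀ (by positivity)]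

lemma flhWeight_le_one {t i : ℕ} (hi : i ∈ Icc 1 t) : flhWeight ζ E f t i ≤ 1 := by
  have ht : 1 ≤ t := (mem_Icc.1 hi).1.trans (mem_Icc.1 hi).2
  exact sum_flhWeight ζ E f ht ▸
    single_le_sum (fun j hj => (flhWeight_pos ζ E f ht j hj).le) hi

variable {ζ E f} {s : Set ℝ}

lemma flhPlay_mem (hs : Convex ℝ s) {t : ℕ} (ht : 1 ≤ t) (hE : ∀ i ∈ Icc 1 t, E i t ∈ s) :
    flhPlay ζ E f t ∈ s :=
  hs.sum_mem (fun i hi => (flhWeight_pos ζ E f ht i hi).le) (sum_flhWeight ζ E f ht) hE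

lemma flhMix_le_exp {t : ℕ} (ht : 1 ≤ t)
    (hf : ConcaveOn ℝ s fun z => Real.exp (-ζ * f t z)) (hE : ∀ i ∈ Icc 1 t, E i t ∈ s) :
    flhMix ζ E f t ≤ Real.exp (-ζ * f t (flhPlay ζ E f t)) :=
  hf.le_map_sum (fun i hi => (flhWeight_pos ζ E f ht i hi).le) (sum_flhWeight ζ E f ht) hE

lemma log_flhWeight_succ {t i : ℕ} (hi : i ∈ Icc 1 t) :
    Real.log (flhWeight ζ E f (t + 1) i) + Real.log ((t + 1 : ℕ) : ℝ) =
      Real.log (flhWeight ζ E f t i) + Real.log t - ζ * f t (E i t)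
        - Real.log (flhMix ζ E f t) := by
  have ht : 0 < t := (mem_Icc.1 hi).1.trans (mem_Icc.1 hi).2
  have hv := flhWeight_pos ζ E f ht i hi
  have hZ := flhMix_pos ζ E f ht
  rw [flhWeight_succ_of_le ζ E f (mem_Icc.1 hi).2, Real.log_mul (by positivity) (by positivity),
    Real.log_mul (by positivity) (by positivity), Real.log_div (by positivity) hZ.ne',
    Real.log_mul hv.ne' (Real.exp_ne_zero _), Real.log_exp, Real.log_inv]
  push_cast
  ring

lemma flh_regret_le_log_flhWeight {r m : ℕ} (hr : 1 ≤ r) (hrm : r ≤ m)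
    (hf : ∀ t ∈ Ico r m, ConcaveOn ℝ s fun z => Real.exp (-ζ * f t z))
    (hE : ∀ t ∈ Ico r m, ∀ i ∈ Icc 1 t, E i t ∈ s) :
    ζ * ∑ t ∈ Ico r m, (f t (flhPlay ζ E f t) - f t (E r t)) ≤
      Real.log (flhWeight ζ E f m r) + Real.log m := by
  induction m, hrm using Nat.le_induction with
  | base =>
    obtain ⟨q, rfl⟩ : ∃ q, r = q + 1 := ⟨r - 1, by lia⟩
    simp [flhWeight_succ_self]
  | succ m hrm ih =>
    have hm : m ∈ Ico r (m + 1) := by simp [hrm]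
    have hsub : Ico r m ⊆ Ico r (m + 1) := Ico_subset_Ico_right (by lia)
    have ih := ih (fun t ht => hf t (hsub ht)) (fun t ht => hE t (hsub ht))
    have hmix := Real.log_le_log (flhMix_pos ζ E f (hr.trans hrm))
      (flhMix_le_exp (hr.trans hrm) (hf m hm) (hE m hm))
    rw [Real.log_exp] at hmix
    rw [sum_Ico_succ_top hrm, log_flhWeight_succ (mem_Icc.2 ⟨hr, hrm⟩)]
    linarith

lemma flh_regret {r m : ℕ} (hr : 1 ≤ r) (hrm : r ≤ m)
    (hf : ∀ t ∈ Ico r m, ConcaveOn ℝ s fun z => Real.exp (-ζ * f t z))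
    (hE : ∀ t ∈ Ico r m, ∀ i ∈ Icc 1 t, E i t ∈ s) :
    ζ * ∑ t ∈ Ico r m, (f t (flhPlay ζ E f t) - f t (E r t)) ≤ Real.log m := by
  have hr' : r ∈ Icc 1 m := mem_Icc.2 ⟨hr, hrm⟩
  have hv := Real.log_nonpos (flhWeight_pos ζ E f (hr.trans hrm) r hr').le
    (flhWeight_le_one ζ E f hr')
  linarith [flh_regret_le_log_flhWeight hr hrm hf hE]

end Flh

/-! ### Adaptive regret of FLH-OGD -/

section AdaptiveRegret

variable {B G L κ ζ : ℝ} {z : ℕ → ℝ} {n : ℕ}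

/-- Adaptive regret over the first `n` rounds, where `ρ t u` is the regret in round `t` against the
point `u`: on every interval of rounds `r, …, s - 1`, the regret against a comparator sequence in
`[-B, B]` is at most `L`, plus `κ` times the length of the interval times the variation of the
comparator within it. In particular `L` bounds the regret against every constant comparator. -/
def HasAdaptiveRegret (ρ : ℕ → ℝ → ℝ) (B L κ : ℝ) (n : ℕ) : Prop :=
  ∀ (v : ℕ → ℝ) (r s : ℕ), 1 ≤ r → r ≤ s → s ≤ n + 1 → (∀ t ∈ Ico r s, v t ∈ Set.Icc (-B) B) →
    ∑ t ∈ Ico r s, ρ t (v t) ≤ L + κ * ((s : ℝ) - r) * pathLength v r s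

lemma flhOgd_mem (hz : ∀ j, z j ∈ Set.Icc (-B) B) (ζ : ℝ) (f : ℕ → ℝ → ℝ) {t : ℕ} (ht : 1 ≤ t) :
    flhOgd B ζ z f t ∈ Set.Icc (-B) B :=
  flhPlay_mem (convex_Icc _ _) ht fun i _ => ogd_mem (hz i) f i (t - i)

lemma log_le_one_add_log {s : ℕ} (hs : s ≤ n + 1) : Real.log s ≤ 1 + Real.log n := by
  rcases s.eq_zero_or_pos with rfl | hs0
  · simpa using add_nonneg zero_le_one (Real.log_natCast_nonneg n)
  calc Real.log s ≤ Real.log (n + 1 : ℕ) := by gcongr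
    _ ≤ harmonic n := log_add_one_le_harmonic n
    _ ≤ 1 + Real.log n := harmonic_le_one_add_log n

lemma harmonic_le_one_add_log_of_le {m : ℕ} (hm : m ≤ n) : harmonic m ≤ 1 + Real.log n := by
  rcases m.eq_zero_or_pos with rfl | hm0
  · simpa using add_nonneg zero_le_one (Real.log_natCast_nonneg n)
  · refine (harmonic_le_one_add_log m).trans ?_
    gcongr

theorem flhOgd_hasAdaptiveRegret (hζ : 0 < ζ) (hz : ∀ j, z j ∈ Set.Icc (-B) B)
    {f : ℕ → ℝ → ℝ} (hf : ∀ t ∈ Icc 1 n, IsOgdLoss B G (f t))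
    (hexp : ∀ t ∈ Icc 1 n, ConcaveOn ℝ (Set.Icc (-B) B) fun u => Real.exp (-ζ * f t u)) :
    HasAdaptiveRegret (fun t u => f t (flhOgd B ζ z f t) - f t u) B
      ((1 / ζ + G ^ 2 / 4) * (1 + Real.log n)) (4 * B) n := by
  intro v r s hr hrs hs hv
  obtain ⟨m, rfl⟩ := Nat.exists_eq_add_of_le hrs
  have hsub : ∀ t ∈ Ico r (r + m), t ∈ Icc 1 n := fun t ht => by
    simp only [mem_Ico, mem_Icc] at ht ⊢
    lia
  set E : ℕ → ℕ → ℝ := fun j t => ogd B (z j) f j (t - j)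
  have hflh : ∑ t ∈ Ico r (r + m), (f t (flhOgd B ζ z f t) - f t (E r t)) ≤
      1 / ζ * (1 + Real.log n) := by
    rw [one_div, ← div_eq_inv_mul, le_div_iff₀' hζ]
    exact (flh_regret hr hrs (fun t ht => hexp t (hsub t ht))
      fun t _ i _ => ogd_mem (hz i) f i (t - i)).trans (log_le_one_add_log hs)
  have hogd : ∑ t ∈ Ico r (r + m), (f t (E r t) - f t (v t)) ≤
      G ^ 2 / 4 * (1 + Real.log n) + 4 * B * m * pathLength v r (r + m) := by
    refine (ogd_dynamic_regret (hz r) m (fun t ht => hf t (hsub t ht)) hv).trans ?_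
    gcongr
    exact harmonic_le_one_add_log_of_le (by lia)
  calc ∑ t ∈ Ico r (r + m), (f t (flhOgd B ζ z f t) - f t (v t))
      = ∑ t ∈ Ico r (r + m), (f t (flhOgd B ζ z f t) - f t (E r t))
        + ∑ t ∈ Ico r (r + m), (f t (E r t) - f t (v t)) := by
        rw [← sum_add_distrib]
        exact sum_congr rfl fun t _ => by ring
    _ ≤ _ := by
        push_cast
        linarith

end AdaptiveRegret

/-! ### Squared losses -/

section SqLoss

variable {B D : ℝ}

/-- The squared losses `z ↦ (z - y t) ^ 2` with targets `y t`. -/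
def sqLoss (y : ℕ → ℝ) (t : ℕ) (z : ℝ) : ℝ := (z - y t) ^ 2

lemma deriv_sqLoss (y : ℕ → ℝ) (t : ℕ) (z : ℝ) : deriv (sqLoss y t) z = 2 * (z - y t) := by
  have h : HasDerivAt (fun z => (z - y t) ^ 2) (2 * (z - y t)) z := by
    simpa using ((hasDerivAt_id z).sub_const (y t)).fun_pow 2
  exact h.deriv

lemma isOgdLoss_sqLoss {y : ℕ → ℝ} {t : ℕ} (hy : ∀ e ∈ Set.Icc (-B) B, |e - y t| ≤ D) :
    IsOgdLoss B (2 * D) (sqLoss y t) where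
  strong x _ u _ := by
    rw [deriv_sqLoss, sqLoss, sqLoss]
    exact le_of_eq (by ring)
  bound x hx := by
    rw [deriv_sqLoss, abs_mul, abs_two]
    gcongr
    exact hy x hx

lemma concaveOn_exp_neg_sq (c D : ℝ) : ConcaveOn ℝ (Set.Icc (c - D) (c + D))
    fun z => Real.exp (-(1 / (2 * D ^ 2)) * (z - c) ^ 2) := by
  set ζ := 1 / (2 * D ^ 2) with hζ
  have hsq (z : ℝ) : HasDerivAt (fun z => -ζ * (z - c) ^ 2) (-ζ * (2 * (z - c))) z := by
    simpa using (((hasDerivAt_id z).sub_const c).pow 2).const_mul (-ζ)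
  have hlin (z : ℝ) : HasDerivAt (fun z => -ζ * (2 * (z - c))) (-ζ * (2 * 1)) z :=
    (((hasDerivAt_id z).sub_const c).const_mul 2).const_mul (-ζ)
  have h1 (z : ℝ) := (hsq z).exp
  have h2 (z : ℝ) := (h1 z).mul (hlin z)
  refine concaveOn_of_hasDerivWithinAt2_nonpos (convex_Icc _ _)
    (fun z _ => (h1 z).continuousAt.continuousWithinAt) (fun z _ => (h1 z).hasDerivWithinAt)
    (fun z _ => (h2 z).hasDerivWithinAt) fun z hz => ?_
  rw [interior_Icc] at hz
  have hcurv : 2 * ζ * (z - c) ^ 2 ≤ 1 := by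
    rw [hζ, mul_one_div, div_mul_eq_mul_div]
    refine div_le_one_of_le₀ ?_ (by positivity)
    gcongr 2 * ?_
    exact sq_le_sq' (by linarith [hz.1]) (by linarith [hz.2])
  calc _ = Real.exp (-ζ * (z - c) ^ 2) * (2 * ζ) * (2 * ζ * (z - c) ^ 2 - 1) := by ring
    _ ≤ 0 := mul_nonpos_of_nonneg_of_nonpos (by positivity) (by linarith)

theorem flhOgd_sqLoss_hasAdaptiveRegret (hD : 0 < D) {z : ℕ → ℝ}
    (hz : ∀ j, z j ∈ Set.Icc (-B) B) {n : ℕ} {y : ℕ → ℝ}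
    (hy : ∀ t ∈ Icc 1 n, ∀ e ∈ Set.Icc (-B) B, |e - y t| ≤ D) :
    HasAdaptiveRegret
      (fun t u => sqLoss y t (flhOgd B (1 / (2 * D ^ 2)) z (sqLoss y) t) - sqLoss y t u)
      B (3 * D ^ 2 * (1 + Real.log n)) (4 * B) n := by
  have hexp : ∀ t ∈ Icc 1 n, ConcaveOn ℝ (Set.Icc (-B) B) fun u =>
      Real.exp (-(1 / (2 * D ^ 2)) * sqLoss y t u) := fun t ht =>
    (concaveOn_exp_neg_sq (y t) D).subset (fun e he => by
      constructor <;> linarith [abs_le.1 (hy t ht e he)]) (convex_Icc _ _)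
  convert flhOgd_hasAdaptiveRegret (by positivity) hz
    (fun t ht => isOgdLoss_sqLoss (hy t ht)) hexp using 2
  field_simp
  ring

end SqLoss

/-! ### Dynamic regret of piecewise constant comparators -/

section Changes

lemma sum_le_mul_one_add_card_changes {α : Type*} [DecidableEq α] {ρ : ℕ → α → ℝ} {k : ℕ → α}
    {L : ℝ} {n : ℕ} (hL : 0 ≤ L)
    (h : ∀ r ∈ Icc 1 n, ∀ s, r ≤ s → s ≤ n + 1 → ∑ t ∈ Ico r s, ρ t (k r) ≤ L) :
    ∑ t ∈ Ico 1 (n + 1), ρ t (k t) ≤ L * (1 + #{t ∈ Ico 2 (n + 1) | k t ≠ k (t - 1)}) := by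
  rcases n.eq_zero_or_pos with rfl | hn
  · simpa using hL
  have hconst {r s : ℕ} (hr : r ∈ Icc 1 n) (hrs : r ≤ s) (hs : s ≤ n + 1)
      (hk : ∀ t ∈ Ico r s, k t = k r) : ∑ t ∈ Ico r s, ρ t (k t) ≤ L := by
    rw [sum_congr rfl fun t ht => by rw [hk t ht]]
    exact h r hr s hrs hs
  suffices H : ∀ m, 1 ≤ m → m ≤ n → ∀ s, m ≤ s → s ≤ n + 1 → (∀ t ∈ Ico m s, k t = k m) →
      ∑ t ∈ Ico 1 s, ρ t (k t) ≤ L * (1 + #{t ∈ Ico 2 (m + 1) | k t ≠ k (t - 1)}) from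
    H n hn le_rfl (n + 1) (by lia) le_rfl fun t ht => by
      rw [show t = n from by simp only [mem_Ico] at ht; lia]
  intro m hm
  induction m, hm using Nat.le_induction with
  | base =>
    intro hn s hs hsn hk
    simpa using hconst (mem_Icc.2 ⟨le_rfl, hn⟩) hs hsn hk
  | succ m hm ih =>
    intro hmn s hms hsn hk
    have hblock := hconst (mem_Icc.2 ⟨by lia, hmn⟩) hms hsn hk
    rw [card_filter, sum_Ico_succ_top (by lia), ← card_filter, Nat.add_sub_cancel]
    split_ifs with hc
    · have hbefore := ih (by lia) (m + 1) (by lia) (by lia) fun t ht => by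
        rw [show t = m from by simp only [mem_Ico] at ht; lia]
      rw [← sum_Ico_consecutive _ (show 1 ≤ m + 1 by lia) hms]
      push_cast
      linarith
    · refine ih (by lia) s (by lia) hsn fun t ht => ?_
      rcases (mem_Ico.1 ht).1.eq_or_lt with rfl | hmt
      · rfl
      · rw [hk t (mem_Ico.2 ⟨hmt, (mem_Ico.1 ht).2⟩), not_not.1 hc]

lemma card_changes_le_sum_abs_sub (k : ℕ → ℤ) (s : Finset ℕ) :
    (#{t ∈ s | k t ≠ k (t - 1)} : ℝ) ≤ ∑ t ∈ s, |(k t : ℝ) - k (t - 1)| := by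
  rw [card_filter]
  push_cast
  refine sum_le_sum fun t _ => ?_
  split_ifs with h
  · exact_mod_cast Int.one_le_abs (sub_ne_zero.2 h)
  · exact abs_nonneg _

end Changes

/-! ### Rounding with a random threshold -/

section Rounding

lemma monotone_floor_add (a : ℝ) : Monotone fun θ : ℝ => (⌊a + θ⌋ : ℝ) := fun x y h => by
  dsimp only
  gcongr

lemma intervalIntegrable_floor_add (a : ℝ) :
    IntervalIntegrable (fun θ => (⌊a + θ⌋ : ℝ)) MeasureTheory.volume 0 1 :=
  (monotone_floor_add a).intervalIntegrable

lemma integral_fract_add (a : ℝ) : ∫ θ in (0 : ℝ)..1, Int.fract (a + θ) = 1 / 2 := by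
  have hper : Function.Periodic (Int.fract : ℝ → ℝ) 1 := Int.fract_periodic ℝ
  rw [intervalIntegral.integral_comp_add_left Int.fract a, add_zero,
    hper.intervalIntegral_add_eq a 0, zero_add,
    intervalIntegral.integral_congr_Ioo_of_le zero_le_one
      fun x hx => Int.fract_eq_self.2 ⟨hx.1.le, hx.2⟩]
  simp

lemma integral_floor_add (a : ℝ) : ∫ θ in (0 : ℝ)..1, (⌊a + θ⌋ : ℝ) = a := by
  have hsub : ∫ θ in (0 : ℝ)..1, Int.fract (a + θ) =
      (∫ θ in (0 : ℝ)..1, (a + θ)) - ∫ θ in (0 : ℝ)..1, (⌊a + θ⌋ : ℝ) :=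
    intervalIntegral.integral_sub ((continuous_const.add continuous_id).intervalIntegrable _ _)
      (intervalIntegrable_floor_add a)
  rw [integral_fract_add, intervalIntegral.integral_add (by simp) (by simp)] at hsub
  simp only [intervalIntegral.integral_const, integral_id, smul_eq_mul] at hsub
  linarith

/-- The integrand does not change sign: this is the monotone coupling of the two roundings. -/
lemma integral_abs_floor_add_sub_floor_add (a b : ℝ) :
    ∫ θ in (0 : ℝ)..1, |(⌊a + θ⌋ : ℝ) - ⌊b + θ⌋| = |a - b| := by
  wlog hab : b ≤ a generalizing a b
  · simpa only [abs_sub_comm] using this b a (le_of_not_ge hab)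
  have hmono (θ : ℝ) : (⌊b + θ⌋ : ℝ) ≤ ⌊a + θ⌋ := by gcongr
  simp only [abs_of_nonneg (sub_nonneg.2 (hmono _)), abs_of_nonneg (sub_nonneg.2 hab)]
  rw [intervalIntegral.integral_sub (intervalIntegrable_floor_add a)
    (intervalIntegrable_floor_add b), integral_floor_add, integral_floor_add]

lemma exists_mem_Ioo_le_integral {F : ℝ → ℝ}
    (hF : IntervalIntegrable F MeasureTheory.volume 0 1) :
    ∃ θ ∈ Set.Ioo (0 : ℝ) 1, F θ ≤ ∫ θ in (0 : ℝ)..1, F θ := by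
  rw [intervalIntegrable_iff_integrableOn_Ioo_of_le zero_le_one] at hF
  have h := MeasureTheory.exists_le_setAverage (by simp) (by simp) hF
  rwa [MeasureTheory.setAverage_eq, MeasureTheory.measureReal_def, Real.volume_Ioo, sub_zero,
    ENNReal.toReal_ofReal zero_le_one, inv_one, one_smul,
    ← MeasureTheory.integral_Ioc_eq_integral_Ioo,
    ← intervalIntegral.integral_of_le zero_le_one] at h

/-- The first moment method for a uniformly random `θ`: `⌊a + θ⌋` has mean `a`. -/
lemma exists_floor_add_le {ι ι' : Type*} (s : Finset ι) (s' : Finset ι') (β a : ι → ℝ)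
    (b c : ι' → ℝ) (L : ℝ) :
    ∃ θ ∈ Set.Ioo (0 : ℝ) 1, ∑ t ∈ s, β t * ((⌊a t + θ⌋ : ℝ) - a t) +
      L * ∑ t ∈ s', |(⌊b t + θ⌋ : ℝ) - ⌊c t + θ⌋| ≤ L * ∑ t ∈ s', |b t - c t| := by
  have hlin (t : ι) : IntervalIntegrable (fun θ => β t * ((⌊a t + θ⌋ : ℝ) - a t))
      MeasureTheory.volume 0 1 :=
    ((intervalIntegrable_floor_add (a t)).sub intervalIntegrable_const).const_mul _
  have habs (t : ι') : IntervalIntegrable (fun θ => |(⌊b t + θ⌋ : ℝ) - ⌊c t + θ⌋|)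
      MeasureTheory.volume 0 1 :=
    ((intervalIntegrable_floor_add (b t)).sub (intervalIntegrable_floor_add (c t))).abs
  have hlins := IntervalIntegrable.sum s fun t _ => hlin t
  have habss := (IntervalIntegrable.sum s' fun t _ => habs t).const_mul L
  simp only [Finset.sum_fn] at hlins habss
  have hmean : ∫ θ in (0 : ℝ)..1, (∑ t ∈ s, β t * ((⌊a t + θ⌋ : ℝ) - a t) +
      L * ∑ t ∈ s', |(⌊b t + θ⌋ : ℝ) - ⌊c t + θ⌋|) = L * ∑ t ∈ s', |b t - c t| := by
    rw [intervalIntegral.integral_add hlins habss, intervalIntegral.integral_const_mul,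
      intervalIntegral.integral_finsetSum fun t _ => hlin t,
      intervalIntegral.integral_finsetSum fun t _ => habs t]
    simp only [integral_abs_floor_add_sub_floor_add, intervalIntegral.integral_const_mul,
      intervalIntegral.integral_sub (intervalIntegrable_floor_add _) intervalIntegrable_const,
      integral_floor_add, intervalIntegral.integral_const]
    simp
  simpa only [hmean] using exists_mem_Ioo_le_integral (hlins.add habss)

/-- The rounding, with threshold `θ`, of `w` to a point of the grid `-B + δ ℤ`. -/
noncomputable def gridRound (B δ θ w : ℝ) : ℝ := δ * ⌊(w + B) / δ + θ⌋ - B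

variable {B L κ δ θ w : ℝ}

lemma gridRound_sub (hδ : δ ≠ 0) :
    gridRound B δ θ w - w = δ * (⌊(w + B) / δ + θ⌋ - (w + B) / δ) := by
  rw [gridRound]
  field_simp
  ring

lemma abs_gridRound_sub_le (hδ : 0 < δ) (hθ : θ ∈ Set.Ioo 0 1) : |gridRound B δ θ w - w| ≤ δ := by
  rw [gridRound_sub hδ.ne', abs_mul, abs_of_pos hδ]
  refine mul_le_of_le_one_right hδ.le (abs_le.2 ?_)
  have hle := Int.floor_le ((w + B) / δ + θ)
  have hlt := Int.lt_floor_add_one ((w + B) / δ + θ)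
  constructor <;> linarith [hθ.1, hθ.2]

lemma gridRound_mem (hδ : 0 < δ) {M : ℕ} (hM : M * δ = 2 * B) (hθ : θ ∈ Set.Ioo 0 1)
    (hw : w ∈ Set.Icc (-B) B) : gridRound B δ θ w ∈ Set.Icc (-B) B := by
  have hnonneg : (0 : ℝ) ≤ ⌊(w + B) / δ + θ⌋ := by
    have : 0 ≤ (w + B) / δ := div_nonneg (by linarith [hw.1]) hδ.le
    exact_mod_cast Int.floor_nonneg.2 (by linarith [hθ.1])
  have hle : (⌊(w + B) / δ + θ⌋ : ℝ) ≤ M := by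
    have : (w + B) / δ ≤ M := (div_le_iff₀ hδ).2 (by linarith [hw.2])
    have hlt : ⌊(w + B) / δ + θ⌋ < (M : ℤ) + 1 :=
      Int.floor_lt.2 (by push_cast; linarith [hθ.2])
    exact_mod_cast Int.lt_add_one_iff.1 hlt
  rw [gridRound]
  constructor <;> nlinarith

variable {ρ : ℕ → ℝ → ℝ} {n : ℕ}

lemma HasAdaptiveRegret.nonneg (h : HasAdaptiveRegret ρ B L κ n) : 0 ≤ L := by
  simpa using h 0 1 1 le_rfl le_rfl (by lia) (by simp)

lemma HasAdaptiveRegret.sum_const_le (h : HasAdaptiveRegret ρ B L κ n) {u : ℝ}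
    (hu : u ∈ Set.Icc (-B) B) {r s : ℕ} (hr : 1 ≤ r) (hrs : r ≤ s) (hs : s ≤ n + 1) :
    ∑ t ∈ Ico r s, ρ t u ≤ L := by
  simpa [pathLength] using h (fun _ => u) r s hr hrs hs fun _ _ => hu

lemma HasAdaptiveRegret.sum_gridRound_le (h : HasAdaptiveRegret ρ B L κ n) {w : ℕ → ℝ}
    (hw : ∀ t ∈ Ico 1 (n + 1), w t ∈ Set.Icc (-B) B) (hδ : 0 < δ) {M : ℕ} (hM : M * δ = 2 * B)
    (hθ : θ ∈ Set.Ioo 0 1) :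
    ∑ t ∈ Ico 1 (n + 1), ρ t (gridRound B δ θ (w t)) ≤
      L * (1 + ∑ t ∈ Ico 2 (n + 1),
        |(⌊(w t + B) / δ + θ⌋ : ℝ) - ⌊(w (t - 1) + B) / δ + θ⌋|) := by
  set k : ℕ → ℤ := fun t => ⌊(w t + B) / δ + θ⌋
  calc ∑ t ∈ Ico 1 (n + 1), ρ t (gridRound B δ θ (w t))
      ≤ L * (1 + #{t ∈ Ico 2 (n + 1) | k t ≠ k (t - 1)}) :=
        sum_le_mul_one_add_card_changes (ρ := fun t k => ρ t (δ * (k : ℤ) - B)) (k := k) h.nonneg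
          fun r hr s hrs hs => h.sum_const_le
            (gridRound_mem hδ hM hθ (hw r (by simpa [Nat.lt_succ_iff] using hr)))
            (mem_Icc.1 hr).1 hrs hs
    _ ≤ _ := by
        gcongr
        · exact h.nonneg
        · exact card_changes_le_sum_abs_sub k _

theorem HasAdaptiveRegret.sum_le_of_rounding (h : HasAdaptiveRegret ρ B L κ n) {w β : ℕ → ℝ}
    (hw : ∀ t ∈ Ico 1 (n + 1), w t ∈ Set.Icc (-B) B) (hδ : 0 < δ) {M : ℕ} (hM : M * δ = 2 * B)
    (hρ : ∀ t ∈ Ico 1 (n + 1), ∀ u ∈ Set.Icc (-B) B,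
      ρ t (w t) ≤ ρ t u + β t * (u - w t) + (u - w t) ^ 2) :
    ∑ t ∈ Ico 1 (n + 1), ρ t (w t) ≤
      n * δ ^ 2 + L * (1 + pathLength w 1 (n + 1) / δ) := by
  obtain ⟨θ, hθ, hθle⟩ := exists_floor_add_le (Ico 1 (n + 1)) (Ico 2 (n + 1))
    (fun t => β t * δ) (fun t => (w t + B) / δ) (fun t => (w t + B) / δ)
    (fun t => (w (t - 1) + B) / δ) L
  have hvar : ∑ t ∈ Ico 2 (n + 1), |(w t + B) / δ - (w (t - 1) + B) / δ| =
      pathLength w 1 (n + 1) / δ := by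
    rw [pathLength, sum_div]
    refine sum_congr rfl fun t _ => ?_
    rw [← sub_div, add_sub_add_right_eq_sub, abs_div, abs_of_pos hδ]
  rw [hvar] at hθle
  calc ∑ t ∈ Ico 1 (n + 1), ρ t (w t)
      ≤ ∑ t ∈ Ico 1 (n + 1), (ρ t (gridRound B δ θ (w t))
          + β t * δ * (⌊(w t + B) / δ + θ⌋ - (w t + B) / δ) + δ ^ 2) := by
        refine sum_le_sum fun t ht => (hρ t ht _ (gridRound_mem hδ hM hθ (hw t ht))).trans ?_
        have hsq : (gridRound B δ θ (w t) - w t) ^ 2 ≤ δ ^ 2 :=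
          sq_le_sq.2 ((abs_gridRound_sub_le hδ hθ).trans (le_abs_self δ))
        rw [mul_assoc, ← gridRound_sub hδ.ne']
        gcongr
    _ = ∑ t ∈ Ico 1 (n + 1), ρ t (gridRound B δ θ (w t))
        + ∑ t ∈ Ico 1 (n + 1), β t * δ * (⌊(w t + B) / δ + θ⌋ - (w t + B) / δ) + n * δ ^ 2 := by
        rw [sum_add_distrib, sum_add_distrib, sum_const, Nat.card_Ico, nsmul_eq_mul,
          Nat.add_sub_cancel]
    _ ≤ _ := by linarith [h.sum_gridRound_le hw hδ hM hθ]

end Rounding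

/-! ### Blocks of equal length -/

section Blocks

variable {ρ : ℕ → ℝ → ℝ} {B L κ : ℝ} {n : ℕ}

lemma pathLength_add_pathLength_le (w : ℕ → ℝ) {r s u : ℕ} (hrs : r < s) (hsu : s ≤ u) :
    pathLength w r s + pathLength w s u ≤ pathLength w r u := by
  rw [pathLength, pathLength, pathLength, ← sum_Ico_consecutive _ hrs hsu]
  gcongr
  exact s.le_succ

theorem HasAdaptiveRegret.sum_le_of_blocks (h : HasAdaptiveRegret ρ B L κ n) (hκ : 0 ≤ κ)
    {w : ℕ → ℝ} (hw : ∀ t ∈ Ico 1 (n + 1), w t ∈ Set.Icc (-B) B) {N : ℕ} (hN : 0 < N) {m : ℕ}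
    (hm : m ≤ n) :
    ∑ t ∈ Ico 1 (m + 1), ρ t (w t) ≤ L * (m / N + 1) + κ * N * pathLength w 1 (m + 1) := by
  have hN' : (0 : ℝ) < N := by exact_mod_cast hN
  have hL := h.nonneg
  have hlast {r s : ℕ} (hr : 1 ≤ r) (hrs : r ≤ s) (hs : s ≤ n + 1) (hlen : s ≤ r + N) :
      ∑ t ∈ Ico r s, ρ t (w t) ≤ L + κ * N * pathLength w r s := by
    refine (h w r s hr hrs hs fun t ht => hw t (Ico_subset_Ico hr hs ht)).trans ?_
    gcongr
    · exact pathLength_nonneg w r s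
    · rw [sub_le_iff_le_add']
      exact_mod_cast hlen
  induction m using Nat.strong_induction_on with
  | _ m ih =>
    rcases Nat.lt_or_ge N m with hlt | hge
    · have hfirst := ih (m - N) (by lia) (by lia)
      rw [Nat.cast_sub hlt.le, sub_div, div_self hN'.ne'] at hfirst
      have hpath := mul_le_mul_of_nonneg_left (pathLength_add_pathLength_le w
        (show 1 < m - N + 1 by lia) (show m - N + 1 ≤ m + 1 by lia)) (mul_nonneg hκ hN'.le)
      rw [← sum_Ico_consecutive _ (show 1 ≤ m - N + 1 by lia) (show m - N + 1 ≤ m + 1 by lia)]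
      linarith [hlast (show 1 ≤ m - N + 1 by lia) (by lia) (show m + 1 ≤ n + 1 by lia) (by lia)]
    · have hm0 : 0 ≤ L * (m / N) := by positivity
      linarith [hlast le_rfl (show 1 ≤ m + 1 by lia) (by lia) (by lia)]

end Blocks

/-! ### From adaptive regret to dynamic regret -/

section DynamicRegret

variable {ρ : ℕ → ℝ → ℝ} {B L κ q : ℝ} {n : ℕ} {w : ℕ → ℝ}

lemma pathLength_le (hB : 0 ≤ B) (hw : ∀ t ∈ Ico 1 (n + 1), w t ∈ Set.Icc (-B) B) :
    pathLength w 1 (n + 1) ≤ 2 * B * n := by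
  have hstep : ∀ t ∈ Ico 2 (n + 1), |w t - w (t - 1)| ≤ 2 * B := fun t ht => by
    rw [mem_Ico] at ht
    have ht' := hw t (mem_Ico.2 ⟨by lia, ht.2⟩)
    have hprev := hw (t - 1) (mem_Ico.2 ⟨by lia, by lia⟩)
    rw [abs_le]
    constructor <;> linarith [ht'.1, ht'.2, hprev.1, hprev.2]
  calc pathLength w 1 (n + 1) ≤ #(Ico 2 (n + 1)) • (2 * B) := sum_le_card_nsmul _ _ _ hstep
    _ ≤ n * (2 * B) := by
        rw [nsmul_eq_mul, Nat.card_Ico]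
        gcongr
        lia
    _ = 2 * B * n := by ring

lemma HasAdaptiveRegret.sum_le_of_le_two_mul (h : HasAdaptiveRegret ρ B L κ n) {β : ℕ → ℝ}
    (hw : ∀ t ∈ Ico 1 (n + 1), w t ∈ Set.Icc (-B) B)
    (hρ : ∀ t ∈ Ico 1 (n + 1), ∀ u ∈ Set.Icc (-B) B,
      ρ t (w t) ≤ ρ t u + β t * (u - w t) + (u - w t) ^ 2)
    (hq : 0 < q) (hqB : q ≤ 2 * B) (hV : pathLength w 1 (n + 1) ≤ q ^ 3 * n) :
    ∑ t ∈ Ico 1 (n + 1), ρ t (w t) ≤ n * q ^ 2 + L * (1 + 2 * (n * q ^ 2)) := by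
  have hL := h.nonneg
  have hB : 0 < 2 * B := by linarith
  set M := ⌈2 * B / q⌉₊
  have hM : (0 : ℝ) < M := by exact_mod_cast Nat.ceil_pos.2 (by positivity)
  have hδ_le : 2 * B / M ≤ q := (div_le_comm₀ hM hq).2 (Nat.le_ceil _)
  have hle_δ : q ≤ 2 * (2 * B / M) := by
    have hM_le : (M : ℝ) ≤ 2 * B / q + 1 := (Nat.ceil_lt_add_one (by positivity)).le
    have hone_le : 1 ≤ 2 * B / q := (one_le_div hq).2 hqB
    rw [mul_div_assoc', le_div_comm₀ hq hM, mul_div_assoc]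
    linarith
  calc ∑ t ∈ Ico 1 (n + 1), ρ t (w t)
      ≤ n * (2 * B / M) ^ 2 + L * (1 + pathLength w 1 (n + 1) / (2 * B / M)) :=
        h.sum_le_of_rounding hw (by positivity) (mul_div_cancel₀ _ hM.ne') hρ
    _ ≤ n * q ^ 2 + L * (1 + 2 * (n * q ^ 2)) := by
        gcongr
        rw [div_le_iff₀ (by positivity)]
        calc pathLength w 1 (n + 1) ≤ n * q ^ 2 * q := by linarith
          _ ≤ n * q ^ 2 * (2 * (2 * B / M)) := by gcongr
          _ = 2 * (n * q ^ 2) * (2 * B / M) := by ring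

lemma HasAdaptiveRegret.sum_le_of_le_one (h : HasAdaptiveRegret ρ B L κ n) (hκ : 0 ≤ κ)
    (hw : ∀ t ∈ Ico 1 (n + 1), w t ∈ Set.Icc (-B) B)
    (hq : 0 < q) (hq1 : q ≤ 1) (hκq : κ ≤ 2 * q) (hV : pathLength w 1 (n + 1) ≤ q ^ 3 * n) :
    ∑ t ∈ Ico 1 (n + 1), ρ t (w t) ≤ 4 * (n * q ^ 2) + L * (1 + n * q ^ 2) := by
  have hL := h.nonneg
  set N := ⌈1 / q ^ 2⌉₊
  have hN : 0 < N := Nat.ceil_pos.2 (by positivity)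
  have hle_N : 1 / q ^ 2 ≤ N := Nat.le_ceil _
  have hN_le : (N : ℝ) ≤ 2 / q ^ 2 := by
    have hone_le : 1 ≤ 1 / q ^ 2 := (one_le_div (by positivity)).2 (pow_le_one₀ hq.le hq1)
    have hceil : (N : ℝ) < 1 / q ^ 2 + 1 := Nat.ceil_lt_add_one (by positivity)
    rw [← one_add_one_eq_two, add_div]
    linarith
  calc ∑ t ∈ Ico 1 (n + 1), ρ t (w t)
      ≤ L * (n / N + 1) + κ * N * pathLength w 1 (n + 1) :=
        h.sum_le_of_blocks hκ hw hN le_rfl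
    _ ≤ L * (n / (1 / q ^ 2) + 1) + 2 * q * (2 / q ^ 2) * (q ^ 3 * n) := by
        gcongr
        exact pathLength_nonneg w 1 (n + 1)
    _ = 4 * (n * q ^ 2) + L * (1 + n * q ^ 2) := by
        field_simp
        ring

lemma exists_eq_pow_three_mul {V N : ℝ} (hV : 0 ≤ V) (hN : 0 < N) :
    ∃ q, 0 ≤ q ∧ V = q ^ 3 * N ∧ N ^ (1 / 3 : ℝ) * V ^ (2 / 3 : ℝ) = N * q ^ 2 := by
  obtain ⟨q, hq, rfl⟩ : ∃ q, 0 ≤ q ∧ V = q ^ 3 * N := by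
    refine ⟨(V / N) ^ (1 / 3 : ℝ), by positivity, ?_⟩
    rw [← Real.rpow_natCast, ← Real.rpow_mul (by positivity), Nat.cast_ofNat,
      one_div_mul_cancel three_ne_zero, Real.rpow_one, div_mul_cancel₀ _ hN.ne']
  refine ⟨q, hq, rfl, ?_⟩
  rw [Real.mul_rpow (by positivity) hN.le, ← Real.rpow_natCast, ← Real.rpow_mul hq, mul_left_comm,
    ← Real.rpow_add hN, show (3 : ℕ) * (2 / 3 : ℝ) = (2 : ℕ) by norm_num,
    show (1 / 3 + 2 / 3 : ℝ) = 1 by norm_num, Real.rpow_one, Real.rpow_natCast, mul_comm]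

theorem HasAdaptiveRegret.dynamic_regret (h : HasAdaptiveRegret ρ B L (4 * B) n) (hB : 0 ≤ B)
    (hw : ∀ t ∈ Ico 1 (n + 1), w t ∈ Set.Icc (-B) B) {β : ℕ → ℝ}
    (hρ : ∀ t ∈ Ico 1 (n + 1), ∀ u ∈ Set.Icc (-B) B,
      ρ t (w t) ≤ ρ t u + β t * (u - w t) + (u - w t) ^ 2) :
    ∑ t ∈ Ico 1 (n + 1), ρ t (w t) ≤ (2 * L + 4) *
      (1 + (n : ℝ) ^ (1 / 3 : ℝ) * pathLength w 1 (n + 1) ^ (2 / 3 : ℝ)) := by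
  have hL := h.nonneg
  rcases n.eq_zero_or_pos with rfl | hn
  · rw [zero_add, Ico_self, sum_empty]
    have hV := pathLength_nonneg w 1 (0 + 1)
    positivity
  have hn' : (0 : ℝ) < n := by exact_mod_cast hn
  obtain ⟨q, hq, hV, hQ⟩ := exists_eq_pow_three_mul (pathLength_nonneg w 1 (n + 1)) hn'
  rw [hQ]
  have hnq : 0 ≤ n * q ^ 2 := by positivity
  have hLnq := mul_nonneg hL hnq
  rcases hq.eq_or_lt with rfl | hq
  · have hall := h w 1 (n + 1) le_rfl (by lia) le_rfl hw
    rw [hV] at hall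
    linarith
  rcases le_or_gt q (2 * B) with hqB | hqB
  · linarith [h.sum_le_of_le_two_mul hw hρ hq hqB hV.le]
  · have hq1 : q ≤ 1 := by
      have hcube : q ^ 3 ≤ 2 * B := le_of_mul_le_mul_right (hV ▸ pathLength_le hB hw) hn'
      by_contra! hq1
      linarith [le_self_pow₀ hq1.le three_ne_zero]
    linarith [h.sum_le_of_le_one (by positivity) hw hq hq1 (by linarith) hV.le]

theorem flhOgd_sqLoss_dynamic_regret {D : ℝ} (hD : 0 < D) {z : ℕ → ℝ}
    (hz : ∀ j, z j ∈ Set.Icc (-B) B) {y : ℕ → ℝ}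
    (hy : ∀ t ∈ Icc 1 n, ∀ e ∈ Set.Icc (-B) B, |e - y t| ≤ D)
    (hw : ∀ t ∈ Icc 1 n, w t ∈ Set.Icc (-B) B) :
    ∑ t ∈ Icc 1 n,
        (sqLoss y t (flhOgd B (1 / (2 * D ^ 2)) z (sqLoss y) t) - sqLoss y t (w t)) ≤
      (6 * D ^ 2 + 4) * (1 + Real.log n) *
        (1 + (n : ℝ) ^ (1 / 3 : ℝ) * pathLength w 1 (n + 1) ^ (2 / 3 : ℝ)) := by
  have hlog := Real.log_natCast_nonneg n
  have hV := pathLength_nonneg w 1 (n + 1)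
  rw [← Ico_add_one_right_eq_Icc] at hw ⊢
  refine ((flhOgd_sqLoss_hasAdaptiveRegret hD hz hy).dynamic_regret
    (by linarith [(hz 0).1, (hz 0).2]) hw (β := fun t => 2 * (w t - y t))
    fun t _ u _ => le_of_eq (by simp only [sqLoss]; ring)).trans ?_
  gcongr
  linarith

end DynamicRegret

/-! ### Losses on the box -/

section Box

variable {d : ℕ} {H G B : ℝ} {W : Set (Fin d → ℝ)}

lemma mem_box_iff (hB : 0 ≤ B) {x : Fin d → ℝ} : x ∈ box d B ↔ ∀ i, x i ∈ Set.Icc (-B) B := by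
  simp only [box, Set.mem_ofPred_eq, pi_norm_le_iff_of_nonneg hB, Real.norm_eq_abs, abs_le,
    Set.mem_Icc]

lemma boxRadius_nonneg (W : Set (Fin d → ℝ)) : 0 ≤ boxRadius W :=
  Real.sSup_nonneg (by rintro _ ⟨w, _, rfl⟩; exact norm_nonneg w)

lemma subset_box (hW : Bornology.IsBounded W) : W ⊆ box d (boxRadius W) := fun w hw => by
  obtain ⟨C, hC⟩ := hW.exists_norm_le
  exact le_csSup ⟨C, by rintro _ ⟨v, hv, rfl⟩; exact hC v hv⟩ ⟨w, hw, rfl⟩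

lemma sum_mul_le_mul_l1Norm {a : Fin d → ℝ} (ha : ∀ i, |a i| ≤ G) (x : Fin d → ℝ) :
    ∑ i, a i * x i ≤ G * l1Norm x := by
  rw [l1Norm, mul_sum]
  refine sum_le_sum fun i _ => (le_abs_self _).trans ?_
  rw [abs_mul]
  gcongr
  exact ha i

variable {f : (Fin d → ℝ) → ℝ} {g : (Fin d → ℝ) → Fin d → ℝ} {x u : Fin d → ℝ}

namespace IsStronglyConvexLoss

lemma abs_grad_le (hf : IsStronglyConvexLoss H G B f g) (hx : x ∈ box d B) (i : Fin d) :
    |g x i| ≤ G :=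
  (norm_le_pi_norm (g x) i).trans (hf.bound x hx)

lemma mul_sum_sq_le (hf : IsStronglyConvexLoss H G B f g) (hx : x ∈ box d B) (hu : u ∈ box d B) :
    H * ∑ i, (x i - u i) ^ 2 ≤ ∑ i, (g x i - g u i) * (x i - u i) := by
  have hsum : ∑ i, (g x i - g u i) * (x i - u i) =
      -(∑ i, g x i * (u i - x i) + ∑ i, g u i * (x i - u i)) := by
    rw [← sum_add_distrib, ← sum_neg_distrib]
    exact sum_congr rfl fun i _ => by ring
  have hxu := hf.strong x hx u hu
  simp only [sub_sq_comm (u _)] at hxu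
  linarith [hf.strong u hu x hx]

/-- Compare two opposite corners of the box. -/
lemma radius_le (hf : IsStronglyConvexLoss H G B f g) (hd : 0 < d) (hH : 0 < H) (hB : 0 ≤ B) :
    B ≤ G / H := by
  have hx : (fun _ => B) ∈ box d B := (mem_box_iff hB).2 fun _ => ⟨by linarith, le_rfl⟩
  have hu : (fun _ => -B) ∈ box d B := (mem_box_iff hB).2 fun _ => ⟨le_rfl, by linarith⟩
  rcases hB.eq_or_lt with rfl | hB'
  · exact div_nonneg ((norm_nonneg _).trans (hf.bound _ hx)) hH.le
  have hgrad : ∀ i ∈ univ, (g (fun _ => B) i - g (fun _ => -B) i) * (B - -B) ≤ 4 * (B * G) :=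
    fun i _ => by
      nlinarith [abs_le.1 (hf.abs_grad_le hx i), abs_le.1 (hf.abs_grad_le hu i)]
  have hmono := (hf.mul_sum_sq_le hx hu).trans (sum_le_card_nsmul _ _ _ hgrad)
  rw [sum_const, card_univ, Fintype.card_fin, nsmul_eq_mul, nsmul_eq_mul] at hmono
  rw [le_div_iff₀' hH]
  have hd' : (0 : ℝ) < d := by exact_mod_cast hd
  refine le_of_mul_le_mul_left ?_ (mul_pos (mul_pos four_pos hd') hB')
  linarith

lemma le_add_l1Norm (hf : IsStronglyConvexLoss H G B f g) (hH : 0 ≤ H) (hx : x ∈ box d B)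
    (hu : u ∈ box d B) : f u ≤ f x + G * l1Norm (u - x) := by
  have hstrong := hf.strong u hu x hx
  have hgrad := sum_mul_le_mul_l1Norm (hf.abs_grad_le hu) (u - x)
  have hsq : 0 ≤ H / 2 * ∑ i, (x i - u i) ^ 2 := by positivity
  simp only [Pi.sub_apply, ← neg_sub (x _), mul_neg, sum_neg_distrib] at hgrad
  linarith

end IsStronglyConvexLoss

/-! ### The surrogate loss -/

variable {proj : (Fin d → ℝ) → Fin d → ℝ}

lemma l1Norm_sub_comm (x u : Fin d → ℝ) : l1Norm (x - u) = l1Norm (u - x) := by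
  simp only [l1Norm, Pi.sub_apply, abs_sub_comm]

lemma l1Gap_eq_zero (hproj : IsL1Projection W proj) (hu : u ∈ W) : l1Gap proj u = 0 := by
  refine le_antisymm ?_ (show 0 ≤ l1Norm _ from sum_nonneg fun _ _ => abs_nonneg _)
  simpa [l1Gap, l1Norm] using (hproj u).2 u hu

lemma l1Gap_le (hproj : IsL1Projection W proj) (x u : Fin d → ℝ) :
    l1Gap proj u ≤ l1Norm (u - x) + l1Gap proj x := by
  refine ((hproj u).2 _ (hproj x).1).trans ?_
  simp only [l1Gap, l1Norm, ← sum_add_distrib, Pi.sub_apply]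
  exact sum_le_sum fun i _ => abs_sub_le _ _ _

lemma abs_subgradient_l1Gap_le (hproj : IsL1Projection W proj) {s : Fin d → ℝ}
    (hs : s ∈ subdifferential (l1Gap proj) x) (i : Fin d) : |s i| ≤ 1 := by
  have hdir (c : ℝ) : s i * c ≤ |c| := by
    have hsub := hs (x + Pi.single i c)
    have hlip := l1Gap_le hproj x (x + Pi.single i c)
    simp only [l1Norm, Pi.add_apply, add_sub_cancel_left] at hsub hlip
    rw [Fintype.sum_eq_single i fun j hj => by simp [hj]] at hsub hlip
    simp only [Pi.single_eq_same] at hsub hlip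
    linarith
  have hone := hdir 1
  have hneg := hdir (-1)
  rw [abs_neg] at hneg
  rw [abs_one] at hone hneg
  exact abs_le.2 ⟨by linarith, by linarith⟩

lemma abs_surrogateGradient_le (hproj : IsL1Projection W proj)
    (hf : IsStronglyConvexLoss H G B f g) (hx : x ∈ box d B) {p : Fin d → ℝ}
    (hp : p ∈ surrogateGradients G proj g x) (i : Fin d) : |p i| ≤ 2 * G := by
  obtain ⟨s, hs, rfl⟩ := hp
  have hg := hf.abs_grad_le hx i
  have hG : 0 ≤ G := (abs_nonneg _).trans hg
  calc |g x i + G * s i| ≤ |g x i| + |G * s i| := abs_add_le _ _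
    _ ≤ G + G * 1 := by
        rw [abs_mul, abs_of_nonneg hG]
        gcongr
        exact abs_subgradient_l1Gap_le hproj hs i
    _ = 2 * G := by ring

/-- Completing the square turns the lower bound given by strong convexity into a difference of
squared losses. -/
lemma sum_mul_add_eq_sum_sq (hH : H ≠ 0) (x p u : Fin d → ℝ) :
    ∑ i, p i * (u i - x i) + H / 2 * ∑ i, (u i - x i) ^ 2 =
      -(H / 2 * ∑ i, ((x i - (x i - p i / H)) ^ 2 - (u i - (x i - p i / H)) ^ 2)) := by
  rw [mul_sum, mul_sum, ← sum_add_distrib, ← sum_neg_distrib]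
  refine sum_congr rfl fun i _ => ?_
  field_simp
  ring

lemma sub_le_sum_sq_sub_sq (hH : 0 < H) (hG : 0 ≤ G) (hWB : W ⊆ box d B)
    (hproj : IsL1Projection W proj) (hf : IsStronglyConvexLoss H G B f g) (hx : x ∈ box d B)
    {p : Fin d → ℝ} (hp : p ∈ surrogateGradients G proj g x) (hu : u ∈ W) :
    f (proj x) - f u ≤
      H / 2 * ∑ i, ((x i - (x i - p i / H)) ^ 2 - (u i - (x i - p i / H)) ^ 2) := by
  have hsquare := sum_mul_add_eq_sum_sq hH.ne' x p u
  obtain ⟨s, hs, rfl⟩ := hp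
  have hgap := mul_le_mul_of_nonneg_left (hs u) hG
  rw [l1Gap_eq_zero hproj hu, mul_zero, mul_add, mul_sum] at hgap
  have hplay : f (proj x) ≤ f x + G * l1Gap proj x := by
    rw [l1Gap, l1Norm_sub_comm]
    exact hf.le_add_l1Norm hH.le hx (hWB (hproj x).1)
  simp only [Pi.add_apply, Pi.smul_apply, smul_eq_mul, add_mul, sum_add_distrib, mul_assoc]
    at hsquare ⊢
  linarith [hf.strong x hx u (hWB hu)]

end Box

/-! ### The reduction -/

section Reduction

lemma sum_rpow_le_card_rpow_mul_rpow_sum {ι : Type*} (s : Finset ι) {V : ι → ℝ}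
    (hV : ∀ i ∈ s, 0 ≤ V i) {p : ℝ} (hp0 : 0 ≤ p) (hp1 : p ≤ 1) :
    ∑ i ∈ s, V i ^ p ≤ (#s : ℝ) ^ (1 - p) * (∑ i ∈ s, V i) ^ p := by
  rcases s.eq_empty_or_nonempty with rfl | hs
  · rw [sum_empty, sum_empty]
    positivity
  have hs' : (0 : ℝ) < #s := by exact_mod_cast hs.card_pos
  have hjensen := (Real.concaveOn_rpow hp0 hp1).le_map_sum (t := s) (w := fun _ => (#s : ℝ)⁻¹)
    (fun _ _ => by positivity) (by simp [hs'.ne']) hV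
  simp only [smul_eq_mul, ← mul_sum] at hjensen
  rw [Real.mul_rpow (by positivity) (sum_nonneg hV), Real.inv_rpow hs'.le,
    inv_mul_le_iff₀ hs'] at hjensen
  rwa [Real.rpow_sub hs', Real.rpow_one, div_mul_eq_mul_div, mul_div_assoc, div_eq_inv_mul]

lemma totalVariation_eq_sum_pathLength {d : ℕ} (n : ℕ) (w : ℕ → Fin d → ℝ) :
    totalVariation n w = ∑ i, pathLength (fun t => w t i) 1 (n + 1) := by
  simp only [totalVariation, l1Norm, pathLength, Pi.sub_apply, Ico_add_one_right_eq_Icc]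
  exact sum_comm

lemma sum_one_add_rpow_pathLength_le {d n : ℕ} {w : ℕ → Fin d → ℝ} {C : ℝ}
    (hC : totalVariation n w ≤ C) :
    ∑ i, (1 + (n : ℝ) ^ (1 / 3 : ℝ) * pathLength (fun t => w t i) 1 (n + 1) ^ (2 / 3 : ℝ)) ≤
      2 * max ((d : ℝ) ^ (1 / 3 : ℝ) * (n : ℝ) ^ (1 / 3 : ℝ) * C ^ (2 / 3 : ℝ)) (d : ℝ) := by
  have hV (i : Fin d) : 0 ≤ pathLength (fun t => w t i) 1 (n + 1) := pathLength_nonneg _ _ _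
  rw [totalVariation_eq_sum_pathLength] at hC
  calc _ = d + (n : ℝ) ^ (1 / 3 : ℝ) *
        ∑ i, pathLength (fun t => w t i) 1 (n + 1) ^ (2 / 3 : ℝ) := by
        rw [sum_add_distrib, ← mul_sum, Fin.sum_const, nsmul_one]
    _ ≤ d + (n : ℝ) ^ (1 / 3 : ℝ) * ((d : ℝ) ^ (1 / 3 : ℝ) * C ^ (2 / 3 : ℝ)) := by
        gcongr
        refine (sum_rpow_le_card_rpow_mul_rpow_sum univ (fun i _ => hV i) (by norm_num)
          (by norm_num)).trans ?_
        rw [card_fin, show (1 - 2 / 3 : ℝ) = 1 / 3 by norm_num]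
        gcongr
        exact sum_nonneg fun i _ => hV i
    _ = d + (d : ℝ) ^ (1 / 3 : ℝ) * (n : ℝ) ^ (1 / 3 : ℝ) * C ^ (2 / 3 : ℝ) := by ring
    _ ≤ _ := by
        rw [two_mul, add_comm]
        exact add_le_add (le_max_left _ _) (le_max_right _ _)

namespace IsReductionRun

variable {d n : ℕ} {W : Set (Fin d → ℝ)} {H G : ℝ} {f : ℕ → (Fin d → ℝ) → ℝ}
  {g : ℕ → (Fin d → ℝ) → (Fin d → ℝ)} {proj : (Fin d → ℝ) → (Fin d → ℝ)}
  {z₁ : Fin d → ℕ → ℝ} {p x xhat w : ℕ → Fin d → ℝ}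

lemma xhat_mem (hrun : IsReductionRun n W H G proj g z₁ p x xhat)
    (hproj : IsL1Projection W proj) {t : ℕ} (ht : t ∈ Icc 1 n) : xhat t ∈ W := by
  rw [hrun.play t ht]
  exact (hproj _).1

lemma coord_mem (hrun : IsReductionRun n W H G proj g z₁ p x xhat) {t : ℕ} (ht : t ∈ Icc 1 n)
    (i : Fin d) : x t i ∈ Set.Icc (-boxRadius W) (boxRadius W) := by
  rw [hrun.predict t ht i]
  exact flhOgd_mem (hrun.start i) _ _ (mem_Icc.1 ht).1

lemma mem_box (hrun : IsReductionRun n W H G proj g z₁ p x xhat) {t : ℕ} (ht : t ∈ Icc 1 n) :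
    x t ∈ box d (boxRadius W) :=
  (mem_box_iff (boxRadius_nonneg W)).2 (hrun.coord_mem ht)

lemma regret_le_sum_coordLoss (hrun : IsReductionRun n W H G proj g z₁ p x xhat) (hH : 0 < H)
    (hG : 0 ≤ G) (hW : Bornology.IsBounded W) (hproj : IsL1Projection W proj)
    (hf : ∀ t ∈ Icc 1 n, IsStronglyConvexLoss H G (boxRadius W) (f t) (g t))
    (hw : ∀ t ∈ Icc 1 n, w t ∈ W) :
    ∑ t ∈ Icc 1 n, (f t (xhat t) - f t (w t)) ≤ H / 2 * ∑ i, ∑ t ∈ Icc 1 n,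
      (coordLoss H x p i t (x t i) - coordLoss H x p i t (w t i)) := by
  rw [sum_comm, mul_sum]
  refine sum_le_sum fun t ht => ?_
  rw [hrun.play t ht]
  exact sub_le_sum_sq_sub_sq hH hG (subset_box hW) hproj (hf t ht) (hrun.mem_box ht)
    (hrun.feedback t ht) (hw t ht)

lemma coord_regret_le_boxRadius (hrun : IsReductionRun n W H G proj g z₁ p x xhat) (hH : 0 < H)
    (hG : 0 < G) (hW : Bornology.IsBounded W) (hproj : IsL1Projection W proj)
    (hf : ∀ t ∈ Icc 1 n, IsStronglyConvexLoss H G (boxRadius W) (f t) (g t))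
    (hw : ∀ t ∈ Icc 1 n, w t ∈ W) (i : Fin d) :
    ∑ t ∈ Icc 1 n, (coordLoss H x p i t (x t i) - coordLoss H x p i t (w t i)) ≤
      (6 * (2 * boxRadius W + 2 * G / H) ^ 2 + 4) * (1 + Real.log n) *
        (1 + (n : ℝ) ^ (1 / 3 : ℝ) * pathLength (fun t => w t i) 1 (n + 1) ^ (2 / 3 : ℝ)) := by
  have hB := boxRadius_nonneg W
  have htarget : ∀ t ∈ Icc 1 n, ∀ e ∈ Set.Icc (-boxRadius W) (boxRadius W),
      |e - (x t i - p t i / H)| ≤ 2 * boxRadius W + 2 * G / H := fun t ht e he => by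
    have hp : |p t i / H| ≤ 2 * G / H := by
      rw [abs_div, abs_of_pos hH]
      gcongr
      exact abs_surrogateGradient_le hproj (hf t ht) (hrun.mem_box ht) (hrun.feedback t ht) i
    have hx := hrun.coord_mem ht i
    rw [abs_le] at hp ⊢
    constructor <;> linarith [hx.1, hx.2, he.1, he.2]
  refine le_of_eq_of_le (sum_congr rfl fun t ht => ?_) (flhOgd_sqLoss_dynamic_regret
    (by positivity) (hrun.start i) htarget
    fun t ht => (mem_box_iff hB).1 (subset_box hW (hw t ht)) i)
  congr
  exact hrun.predict t ht i

lemma coord_regret_le (hrun : IsReductionRun n W H G proj g z₁ p x xhat) (hH : 0 < H)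
    (hG : 0 < G) (hW : Bornology.IsBounded W) (hproj : IsL1Projection W proj)
    (hf : ∀ t ∈ Icc 1 n, IsStronglyConvexLoss H G (boxRadius W) (f t) (g t))
    (hw : ∀ t ∈ Icc 1 n, w t ∈ W) (i : Fin d) :
    ∑ t ∈ Icc 1 n, (coordLoss H x p i t (x t i) - coordLoss H x p i t (w t i)) ≤
      (96 * (G / H) ^ 2 + 4) * (1 + Real.log n) *
        (1 + (n : ℝ) ^ (1 / 3 : ℝ) * pathLength (fun t => w t i) 1 (n + 1) ^ (2 / 3 : ℝ)) := by
  have hB := boxRadius_nonneg W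
  have hlog := Real.log_natCast_nonneg n
  have hV := pathLength_nonneg (fun t => w t i) 1 (n + 1)
  rcases n.eq_zero_or_pos with rfl | hn
  · rw [Icc_eq_empty_of_lt zero_lt_one, sum_empty]
    positivity
  have hradius : boxRadius W ≤ G / H :=
    (hf 1 (mem_Icc.2 ⟨le_rfl, hn⟩)).radius_le i.pos hH hB
  calc _ ≤ (6 * (2 * boxRadius W + 2 * G / H) ^ 2 + 4) * (1 + Real.log n) *
        (1 + (n : ℝ) ^ (1 / 3 : ℝ) * pathLength (fun t => w t i) 1 (n + 1) ^ (2 / 3 : ℝ)) :=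
        hrun.coord_regret_le_boxRadius hH hG hW hproj hf hw i
    _ ≤ (6 * (2 * (G / H) + 2 * G / H) ^ 2 + 4) * (1 + Real.log n) *
        (1 + (n : ℝ) ^ (1 / 3 : ℝ) * pathLength (fun t => w t i) 1 (n + 1) ^ (2 / 3 : ℝ)) := by
        gcongr
    _ = _ := by ring

end IsReductionRun

end Reduction

end BoxReduction

open BoxReduction in
theorem mainTheorem3_general {H G : ℝ} (hH : 0 < H) (hG : 0 < G) {d n : ℕ}
    {W : Set (Fin d → ℝ)} (hW : Bornology.IsBounded W)
    {f : ℕ → (Fin d → ℝ) → ℝ} {g : ℕ → (Fin d → ℝ) → (Fin d → ℝ)}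
    (hf : ∀ t ∈ Icc 1 n, IsStronglyConvexLoss H G (boxRadius W) (f t) (g t))
    {proj : (Fin d → ℝ) → (Fin d → ℝ)} (hproj : IsL1Projection W proj)
    {z₁ : Fin d → ℕ → ℝ} {p x xhat : ℕ → Fin d → ℝ}
    (hrun : IsReductionRun n W H G proj g z₁ p x xhat) :
    (∀ t ∈ Icc 1 n, xhat t ∈ W) ∧
    ∀ (C : ℝ) (w : ℕ → Fin d → ℝ), (∀ t ∈ Icc 1 n, w t ∈ W) → totalVariation n w ≤ C →
      ∑ t ∈ Icc 1 n, (f t (xhat t) - f t (w t)) ≤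
        H * (96 * (G / H) ^ 2 + 4) * (1 + Real.log n) *
          max ((d : ℝ) ^ (1 / 3 : ℝ) * (n : ℝ) ^ (1 / 3 : ℝ) * C ^ (2 / 3 : ℝ)) (d : ℝ) := by
  refine ⟨fun t ht => hrun.xhat_mem hproj ht, fun C w hw hC => ?_⟩
  have : 0 ≤ 1 + Real.log n := by linarith [Real.log_natCast_nonneg n]
  calc ∑ t ∈ Icc 1 n, (f t (xhat t) - f t (w t))
      ≤ H / 2 * ∑ i, ∑ t ∈ Icc 1 n,
          (coordLoss H x p i t (x t i) - coordLoss H x p i t (w t i)) :=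
        hrun.regret_le_sum_coordLoss hH hG.le hW hproj hf hw
    _ ≤ H / 2 * ∑ i, (96 * (G / H) ^ 2 + 4) * (1 + Real.log n) *
          (1 + (n : ℝ) ^ (1 / 3 : ℝ) * pathLength (fun t => w t i) 1 (n + 1) ^ (2 / 3 : ℝ)) := by
        gcongr with i
        exact hrun.coord_regret_le hH hG hW hproj hf hw i
    _ ≤ H / 2 * ((96 * (G / H) ^ 2 + 4) * (1 + Real.log n) * (2 * max
          ((d : ℝ) ^ (1 / 3 : ℝ) * (n : ℝ) ^ (1 / 3 : ℝ) * C ^ (2 / 3 : ℝ)) (d : ℝ))) := by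
        rw [← mul_sum]
        gcongr
        exact sum_one_add_rpow_pathLength_le hC
    _ = _ := by ring

theorem mainTheorem3 :
    ∃ k : ℕ, ∀ H G : ℝ, 0 < H → 0 < G → ∃ K : ℝ, 0 < K ∧
      ∀ (d n : ℕ) (W : Set (Fin d → ℝ)),
        W.Nonempty → Convex ℝ W → IsClosed W → Bornology.IsBounded W →
      ∀ (f : ℕ → (Fin d → ℝ) → ℝ) (g : ℕ → (Fin d → ℝ) → (Fin d → ℝ)),
        (∀ t ∈ Finset.Icc 1 n,
          BoxReduction.IsStronglyConvexLoss H G (BoxReduction.boxRadius W) (f t) (g t)) →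
      ∀ proj : (Fin d → ℝ) → (Fin d → ℝ), BoxReduction.IsL1Projection W proj →
      ∀ (z₁ : Fin d → ℕ → ℝ) (p x xhat : ℕ → Fin d → ℝ),
        BoxReduction.IsReductionRun n W H G proj g z₁ p x xhat →
        (∀ t ∈ Finset.Icc 1 n, xhat t ∈ W) ∧
        ∀ (C : ℝ) (w : ℕ → Fin d → ℝ),
          (∀ t ∈ Finset.Icc 1 n, w t ∈ W) → BoxReduction.totalVariation n w ≤ C →
          ∑ t ∈ Finset.Icc 1 n, (f t (xhat t) - f t (w t)) ≤
            K * (1 + Real.log n) ^ k *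
              max ((d : ℝ) ^ (1 / 3 : ℝ) * (n : ℝ) ^ (1 / 3 : ℝ) * C ^ (2 / 3 : ℝ)) (d : ℝ) :=
  ⟨1, fun H G hH hG => ⟨H * (96 * (G / H) ^ 2 + 4), by positivity,
    fun _ _ _ _ _ _ hW _ _ hf _ hproj _ _ _ _ hrun => by
      simpa only [pow_one] using mainTheorem3_general hH hG hW hf hproj hrun⟩⟩
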